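/- Let $G$ be a group. For an integer $k\ge 1$, a set $A\subseteq G$ is called $k$-stable if there do not exist $a_1,\dots,a_k,b_1,\dots,b_k\in G$ such that, for all $i,j\in\{1,\dots,k\}$, $a_ib_j\in A$ if and only if $i\le j$. Proposition. For every $k\geq 1$ there is a constant $C=C(k)$, depending only on $k$, such that the following holds. Let $G$ be a finite group, let $A\subseteq G$ be $k$-stable, and let $\epsilon>0$. Then there is a normal subgroup $H\le G$ of index at most $2^{\epsilon^{-C}}$ with the following two properties. (1) There is a set $Z\subseteq G$ which is a union of cosets of $H$, with $|Z|<\epsilon|G|$, such that for every $g\in G\setminus Z$, either $|gH\cap A|<\epsilon|H|$ or $|gH\setminus A|<\epsilon|H|$. (2) There is a set $D\subseteq G$ which is a union of cosets of $H$, such that $|A\mathbin{\triangle} D|<\epsilon|G|$. -/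

import Mathlib

open scoped Pointwise symmDiff

/-- A subset `A` of a group `G` is `k`-stable if there are no `a₁, …, aₖ, b₁, …, bₖ` in `G`
such that `aᵢ bⱼ ∈ A` if and only if `i ≤ j`. -/
def IsKStable {G : Type*} [Group G] (k : ℕ) (A : Set G) : Prop :=
  ¬ ∃ a b : Fin k → G, ∀ i j : Fin k, a i * b j ∈ A ↔ i ≤ j

/-- `S` is a (possibly empty) union of left cosets `gH` of `H`. -/
def IsUnionOfCosets {G : Type*} [Group G] (H : Subgroup G) (S : Set G) : Prop :=
  ∃ T : Set G, S = ⋃ g ∈ T, g • (H : Set G)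

/-! Stability bounds the height of binary trees for the relation `g * v ∈ A`. Repeatedly splitting
`G` by translates of `A` therefore stops at a dense set `V`, every left translate of which lies
almost inside or almost outside `A`. Let `D` be the set of `g` with `g • V` almost inside `A`. Right
multiplication by `x` preserves `D` as soon as `x • V` meets `V` substantially. Averaging makes such
`x` numerous, so the stabilizer of `D` has index polynomial in `ε⁻¹`. After a translation of `V`,
`D` approximates `A`. Passing to the normal core costs an exponential, and Markov's inequality
bounds the irregular cosets. -/

/-! ### Binary trees and half graphs -/

/-- `HasBinaryTree R n X B` says that some full binary tree of height `n`, with inner nodes labelled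
by elements of `B` and leaves by elements of `X`, is realised by the relation `R`. -/
def HasBinaryTree {α β : Type*} (R : α → β → Prop) : ℕ → Set α → Set β → Prop
  | 0, X, _ => X.Nonempty
  | n + 1, X, B => ∃ b ∈ B, HasBinaryTree R n (X ∩ {a | R a b}) B ∧
      HasBinaryTree R n (X ∩ {a | ¬ R a b}) B

namespace HasBinaryTree

variable {α β : Type*} {R : α → β → Prop}

theorem mono {n : ℕ} {X Y : Set α} {B : Set β} (h : HasBinaryTree R n X B) (hXY : X ⊆ Y) :
    HasBinaryTree R n Y B := by
  induction n generalizing X Y with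
  | zero => exact Set.Nonempty.mono hXY h
  | succ n ih =>
    obtain ⟨b, hb, h₁, h₂⟩ := h
    exact ⟨b, hb, ih h₁ (Set.inter_subset_inter_left _ hXY),
      ih h₂ (Set.inter_subset_inter_left _ hXY)⟩

theorem nonempty {n : ℕ} {X : Set α} {B : Set β} (h : HasBinaryTree R n X B) : X.Nonempty := by
  induction n generalizing X with
  | zero => exact h
  | succ n ih =>
    obtain ⟨b, -, h₁, -⟩ := h
    exact (ih h₁).mono Set.inter_subset_left

/-- Ramsey property of binary trees under two-colourings of the inner nodes. -/
theorem ramsey (B C : Set β) {m n : ℕ} {X : Set α} (h : HasBinaryTree R (m + n) X (B ∪ C)) :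
    HasBinaryTree R m X B ∨ HasBinaryTree R n X C := by
  obtain ⟨s, hs⟩ : ∃ s, s = m + n := ⟨_, rfl⟩
  induction s generalizing m n X with
  | zero =>
    obtain rfl : m = 0 := by omega
    exact Or.inl h.nonempty
  | succ s ih =>
    rcases m with _ | m
    · exact Or.inl h.nonempty
    rcases n with _ | n
    · exact Or.inr h.nonempty
    rw [← hs] at h
    obtain ⟨b, hb | hb, h₁, h₂⟩ := h
    · have e : s = m + (n + 1) := by omega
      rcases ih (e ▸ h₁) e with h₁ | h₁
      · rcases ih (e ▸ h₂) e with h₂ | h₂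
        · exact Or.inl ⟨b, hb, h₁, h₂⟩
        · exact Or.inr (h₂.mono Set.inter_subset_left)
      · exact Or.inr (h₁.mono Set.inter_subset_left)
    · have e : s = (m + 1) + n := by omega
      rcases ih (e ▸ h₁) e with h₁ | h₁
      · exact Or.inl (h₁.mono Set.inter_subset_left)
      · rcases ih (e ▸ h₂) e with h₂ | h₂
        · exact Or.inl (h₂.mono Set.inter_subset_left)
        · exact Or.inr ⟨b, hb, h₁, h₂⟩

/-- The height of a binary tree which forces a half graph of length `k`. -/
def ladderHeight : ℕ → ℕ
  | 0 => 0
  | k + 1 => 2 * ladderHeight k + 2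

/-- Hodges' lemma: tall binary trees contain long half graphs. -/
theorem exists_halfGraph (k : ℕ) {X : Set α} {B : Set β}
    (h : HasBinaryTree R (ladderHeight k) X B) :
    ∃ (a : Fin k → α) (b : Fin k → β), (∀ i, a i ∈ X) ∧ (∀ i, b i ∈ B) ∧
      ∀ i j, R (a i) (b j) ↔ i ≤ j := by
  induction k generalizing X B with
  | zero => exact ⟨Fin.elim0, Fin.elim0, fun i => i.elim0, fun i => i.elim0, fun i => i.elim0⟩
  | succ k ih =>
    obtain ⟨b₀, hb₀, h₁, -⟩ := h
    obtain ⟨a₀, ha₀, ha₀b₀⟩ := h₁.nonempty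
    -- Colour labels by their relation to the leaf `a₀`. A tree of the first colour lets `a₀` and
    -- its root label start the half graph; one of the second lets `a₀` and `b₀` end it.
    have hB : B = (B ∩ {b | R a₀ b}) ∪ (B ∩ {b | ¬ R a₀ b}) := by
      ext b; by_cases hb : R a₀ b <;> simp [hb]
    have e : 2 * ladderHeight k + 1 = (ladderHeight k + 1) + ladderHeight k := by ring
    rw [hB, e] at h₁
    rcases ramsey _ _ h₁ with h₂ | h₂
    · obtain ⟨b₁, hb₁, -, h₃⟩ := h₂
      obtain ⟨a, b, ha, hb, hab⟩ := ih h₃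
      refine ⟨Fin.cons a₀ a, Fin.cons b₁ b, ?_, ?_, ?_⟩
      · exact Fin.cases ha₀ fun i => (ha i).1.1
      · exact Fin.cases hb₁.1 fun i => (hb i).1
      · refine Fin.cases (Fin.cases ?_ fun j => ?_) (fun i => Fin.cases ?_ fun j => ?_)
        · simpa using hb₁.2
        · simpa using (hb j).2
        · simpa using (ha i).2
        · simpa using hab i j
    · obtain ⟨a, b, ha, hb, hab⟩ := ih h₂
      refine ⟨Fin.snoc a a₀, Fin.snoc b b₀, ?_, ?_, ?_⟩
      · exact Fin.lastCases (by simpa using ha₀) fun i => by simpa using (ha i).1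
      · exact Fin.lastCases (by simpa using hb₀) fun i => by simpa using (hb i).1
      · refine Fin.lastCases (Fin.lastCases ?_ fun j => ?_)
          (fun i => Fin.lastCases ?_ fun j => ?_)
        · simpa using ha₀b₀
        · simpa using (hb j).2
        · simpa [Fin.le_last] using (ha i).2
        · simpa using hab i j

end HasBinaryTree

theorem IsKStable.not_hasBinaryTree {G : Type*} [Group G] {k : ℕ} {A : Set G}
    (hA : IsKStable k A) :
    ¬ HasBinaryTree (fun v g : G => g * v ∈ A) (HasBinaryTree.ladderHeight k)
      Set.univ Set.univ := by
  intro h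
  obtain ⟨a, b, -, -, hab⟩ := h.exists_halfGraph
  -- Group elements multiply on the left, so the two sides swap roles; reversing the indices
  -- restores the order.
  exact hA ⟨b ∘ Fin.rev, a ∘ Fin.rev, fun i j => by simp [hab]⟩

/-! ### Good sets and the stabilizers they define -/

/-- `V` is `δ`-good for `A` if every left translate of `V` is, up to a proportion less than `δ`,
either disjoint from `A` or contained in `A`. -/
def IsGoodSet {G : Type*} [Group G] (A : Set G) (δ : ℝ) (V : Set G) : Prop :=
  ∀ g : G, ((g • V ∩ A).ncard : ℝ) < δ * V.ncard ∨ ((g • V \ A).ncard : ℝ) < δ * V.ncard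

/-- The elements `g` for which `g • V` is contained in `A` up to a proportion less than `δ`. -/
def goodDefinition {G : Type*} [Group G] (A : Set G) (δ : ℝ) (V : Set G) : Set G :=
  {g | ((g • V \ A).ncard : ℝ) < δ * V.ncard}

/-- The stabilizer of a set under right multiplication. -/
def rightStabilizer {G : Type*} [Group G] (D : Set G) : Subgroup G where
  carrier := {x | ∀ g, g * x ∈ D ↔ g ∈ D}
  one_mem' := by simp
  mul_mem' := by
    intro x y hx hy g
    rw [← mul_assoc, hy, hx]
  inv_mem' := by
    intro x hx g
    rw [← hx (g * x⁻¹), inv_mul_cancel_right]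

theorem ncard_smul_inter {G : Type*} [Group G] (g : G) (V A : Set G) :
    (g • V ∩ A).ncard = (V ∩ {v | g * v ∈ A}).ncard := by
  have : g • V ∩ A = g • (V ∩ {v | g * v ∈ A}) := by
    ext x; simp [Set.mem_smul_set_iff_inv_smul_mem]
  rw [this, Set.ncard_smul_set]

theorem ncard_smul_diff {G : Type*} [Group G] (g : G) (V A : Set G) :
    (g • V \ A).ncard = (V ∩ {v | ¬ g * v ∈ A}).ncard :=
  ncard_smul_inter g V Aᶜ

/-- In a set without tall binary trees, there is a large subset whose goodness is much smaller than
its density. -/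
theorem exists_isGoodSet {G : Type*} [Group G] [Finite G] (A : Set G) {ε : ℝ} (hε : 0 < ε)
    (n m : ℕ) (X : Set G) (hX : ε ^ m * Nat.card G ≤ X.ncard)
    (h : ¬ HasBinaryTree (fun v g : G => g * v ∈ A) n X Set.univ) :
    ∃ (m' : ℕ) (V : Set G), m' + 3 ≤ 2 ^ n * (m + 3) ∧ ε ^ m' * Nat.card G ≤ V.ncard ∧
      IsGoodSet A (ε ^ (m' + 3)) V := by
  induction n generalizing m X with
  | zero =>
    have hX0 : X = ∅ := Set.not_nonempty_iff_eq_empty.1 h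
    have : 0 < ε ^ m * Nat.card G := mul_pos (pow_pos hε m) (by exact_mod_cast Nat.card_pos)
    simp [hX0] at hX
    linarith
  | succ n ih =>
    by_cases hg : IsGoodSet A (ε ^ (m + 3)) X
    · exact ⟨m, X, Nat.le_mul_of_pos_left _ (by positivity), hX, hg⟩
    simp only [IsGoodSet, not_forall, not_or, not_lt] at hg
    obtain ⟨g, hg₁, hg₂⟩ := hg
    rw [ncard_smul_inter] at hg₁
    rw [ncard_smul_diff] at hg₂
    -- Passing to a half turns `m` into `2 * m + 3`, which doubles `m + 3`. One of the halves has no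
    -- tree of height `n`.
    have key : ∀ Y : Set G, ε ^ (m + 3) * X.ncard ≤ (Y.ncard : ℝ) →
        ε ^ (2 * m + 3) * Nat.card G ≤ (Y.ncard : ℝ) := fun Y hY => by
      refine le_trans ?_ hY
      calc ε ^ (2 * m + 3) * Nat.card G = ε ^ (m + 3) * (ε ^ m * Nat.card G) := by ring
        _ ≤ _ := by gcongr
    have e : 2 ^ n * (2 * m + 3 + 3) = 2 ^ (n + 1) * (m + 3) := by ring
    rw [← e]
    by_cases h₁ : HasBinaryTree (fun v g : G => g * v ∈ A) n (X ∩ {v | g * v ∈ A}) Set.univ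
    · have h₂ : ¬ HasBinaryTree (fun v g : G => g * v ∈ A) n (X ∩ {v | ¬ g * v ∈ A}) Set.univ :=
        fun h₂ => h ⟨g, Set.mem_univ _, h₁, h₂⟩
      exact ih _ _ (key _ hg₂) h₂
    · exact ih _ _ (key _ hg₁) h₁

theorem sum_ncard_fiber {α β : Type*} [Fintype α] [Fintype β] (R : α → β → Prop) :
    ∑ a, {b | R a b}.ncard = ∑ b, {a | R a b}.ncard := by
  classical
  simp only [Set.ncard_eq_toFinset_card', Set.toFinset_ofPred]
  exact Finset.sum_card_bipartiteAbove_eq_sum_card_bipartiteBelow (s := Finset.univ)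
    (t := Finset.univ) R

theorem card_filter_mem_eq_ncard {α : Type*} [Fintype α] (S : Set α) [DecidablePred (· ∈ S)] :
    (Finset.univ.filter (· ∈ S)).card = S.ncard := by
  rw [← Set.ncard_coe_finset]
  congr 1
  ext
  simp

theorem sum_ncard_smul_inter {G : Type*} [Group G] [Fintype G] (V A : Set G) :
    ∑ g : G, (g • V ∩ A).ncard = V.ncard * A.ncard := by
  classical
  have h := sum_ncard_fiber fun g v : G => v ∈ V ∧ g * v ∈ A
  have h₁ : ∀ g : G, {v | v ∈ V ∧ g * v ∈ A}.ncard = (g • V ∩ A).ncard := fun g =>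
    (ncard_smul_inter g V A).symm
  have h₂ : ∀ v : G, {g | v ∈ V ∧ g * v ∈ A}.ncard = if v ∈ V then A.ncard else 0 := by
    intro v
    by_cases hv : v ∈ V
    · simp only [hv, true_and, if_true]
      exact Set.ncard_preimage_of_injective_subset_range (f := fun g : G => g * v)
        (mul_left_injective v) (fun x _ => ⟨x * v⁻¹, by simp⟩)
    · simp [hv]
  simp only [h₁, h₂] at h
  rw [h, ← Finset.sum_filter, Finset.sum_const, smul_eq_mul, card_filter_mem_eq_ncard]

namespace IsGoodSet

variable {G : Type*} [Group G] {A V : Set G} {δ : ℝ}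

theorem smul (h : IsGoodSet A δ V) (x : G) : IsGoodSet A δ (x • V) := fun g => by
  simpa [smul_smul, Set.ncard_smul_set] using h (g * x)

/-- If exactly one of `g` and `g * x` were in `D`, then one of `g • V`, `(g * x) • V` would be
almost inside `A` and the other almost outside, which leaves too small an intersection. -/
theorem mem_rightStabilizer [Finite G] (h : IsGoodSet A δ V) {x : G}
    (hx : 2 * δ * V.ncard ≤ ((x • V ∩ V).ncard : ℝ)) :
    x ∈ rightStabilizer (goodDefinition A δ V) := by
  have bound : ∀ P Q : Set G, ((P \ A).ncard : ℝ) < δ * V.ncard →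
      ((Q ∩ A).ncard : ℝ) < δ * V.ncard → ((P ∩ Q).ncard : ℝ) < 2 * δ * V.ncard := by
    intro P Q hP hQ
    have hsub : P ∩ Q ⊆ (P \ A) ∪ (Q ∩ A) := by
      intro y hy
      by_cases hyA : y ∈ A
      · exact Or.inr ⟨hy.2, hyA⟩
      · exact Or.inl ⟨hy.1, hyA⟩
    have h₁ := (Set.ncard_le_ncard hsub (Set.toFinite _)).trans (Set.ncard_union_le _ _)
    have h₂ : ((P ∩ Q).ncard : ℝ) ≤ (P \ A).ncard + (Q ∩ A).ncard := by exact_mod_cast h₁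
    linarith
  intro g
  have e : ((g * x) • V ∩ g • V).ncard = (x • V ∩ V).ncard := by
    rw [← smul_smul, ← Set.smul_set_inter, Set.ncard_smul_set]
  constructor <;> intro hg
  · by_contra hg'
    have := bound _ _ hg ((h g).resolve_right hg')
    rw [e] at this
    linarith
  · by_contra hg'
    have := bound _ _ hg ((h (g * x)).resolve_right hg')
    rw [Set.inter_comm, e] at this
    linarith

/-- The intersections `g • V ∩ V` have total size `|V|²`, and each `g` outside the stabilizer
contributes less than `2δ|V|`. -/
theorem le_card_rightStabilizer [Finite G] (h : IsGoodSet A δ V) (hδ : 0 ≤ δ)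
    (hV : 0 < V.ncard) :
    (V.ncard : ℝ) - 2 * δ * Nat.card G ≤ Nat.card (rightStabilizer (goodDefinition A δ V)) := by
  classical
  have := Fintype.ofFinite G
  set H := rightStabilizer (goodDefinition A δ V) with hH
  have hsum : (∑ g : G, ((g • V ∩ V).ncard : ℝ)) = V.ncard * V.ncard := by
    exact_mod_cast sum_ncard_smul_inter V V
  have hle : ∀ g : G, ((g • V ∩ V).ncard : ℝ) ≤
      (if g ∈ H then (V.ncard : ℝ) else 0) + 2 * δ * V.ncard := by
    intro g
    split_ifs with hg
    · have : ((g • V ∩ V).ncard : ℝ) ≤ V.ncard := by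
        exact_mod_cast Set.ncard_le_ncard Set.inter_subset_right (Set.toFinite _)
      have : 0 ≤ 2 * δ * V.ncard := by positivity
      linarith
    · have := mt h.mem_rightStabilizer hg
      linarith
  have h₁ := Finset.sum_le_sum fun g (_ : g ∈ Finset.univ) => hle g
  have hcard : ((Finset.univ.filter (· ∈ H)).card : ℝ) = Nat.card H := by
    rw [Nat.card_eq_fintype_card, Fintype.card_subtype]
  rw [hsum, Finset.sum_add_distrib, ← Finset.sum_filter, Finset.sum_const, Finset.sum_const,
    nsmul_eq_mul, nsmul_eq_mul, hcard, Finset.card_univ, ← Nat.card_eq_fintype_card] at h₁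
  have hV' : (0 : ℝ) < V.ncard := by exact_mod_cast hV
  nlinarith

/-- Count pairs `(g, v)` with `v ∈ V` for which `g * v ∈ A` and `g ∈ D` disagree. Each `g` has fewer
than `δ|V|`, so some `v` has fewer than `δ|G|`; take `x = v⁻¹`. -/
theorem exists_smul_ncard_symmDiff_lt [Finite G] (h : IsGoodSet A δ V) :
    ∃ x : G, ((A ∆ goodDefinition A δ (x • V)).ncard : ℝ) < δ * Nat.card G := by
  classical
  have := Fintype.ofFinite G
  set D := goodDefinition A δ V with hD
  have hsum := sum_ncard_fiber fun g v : G => v ∈ V ∧ (g * v ∈ A ↔ ¬ g ∈ D)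
  have hg : ∀ g : G, ({v | v ∈ V ∧ (g * v ∈ A ↔ ¬ g ∈ D)}.ncard : ℝ) < δ * V.ncard := by
    intro g
    by_cases hg : g ∈ D
    · have h₁ : ((g • V \ A).ncard : ℝ) < δ * V.ncard := hg
      rw [ncard_smul_diff] at h₁
      convert h₁ using 3
      ext v
      simp [hg]
    · have h₁ := (h g).resolve_right hg
      rw [ncard_smul_inter] at h₁
      convert h₁ using 3
      ext v
      simp [hg]
  have hv : ∀ v : G, {g | v ∈ V ∧ (g * v ∈ A ↔ ¬ g ∈ D)}.ncard =
      if v ∈ V then (A ∆ goodDefinition A δ (v⁻¹ • V)).ncard else 0 := by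
    intro v
    by_cases hv : v ∈ V
    · simp only [hv, true_and, if_true]
      rw [← Set.ncard_preimage_of_injective_subset_range (f := fun g : G => g * v)
        (s := A ∆ goodDefinition A δ (v⁻¹ • V)) (mul_left_injective v)
        (fun x _ => ⟨x * v⁻¹, by simp⟩)]
      congr 1
      ext g
      have : g * v ∈ goodDefinition A δ (v⁻¹ • V) ↔ g ∈ D := by
        simp [goodDefinition, hD, smul_smul, Set.ncard_smul_set]
      simp only [Set.mem_ofPred_eq, Set.mem_preimage, Set.mem_symmDiff, this]
      tauto
    · simp [hv]
  by_contra! hx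
  simp only [hv] at hsum
  have hlt : (∑ g : G, ({v | v ∈ V ∧ (g * v ∈ A ↔ ¬ g ∈ D)}.ncard : ℝ)) <
      ∑ _g : G, δ * V.ncard :=
    Finset.sum_lt_sum_of_nonempty Finset.univ_nonempty fun g _ => hg g
  have hsum' : (∑ g : G, ({v | v ∈ V ∧ (g * v ∈ A ↔ ¬ g ∈ D)}.ncard : ℝ)) =
      ∑ v : G, if v ∈ V then ((A ∆ goodDefinition A δ (v⁻¹ • V)).ncard : ℝ) else 0 := by
    exact_mod_cast hsum
  have hge : (∑ v : G, if v ∈ V then δ * Nat.card G else 0) ≤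
      ∑ v : G, if v ∈ V then ((A ∆ goodDefinition A δ (v⁻¹ • V)).ncard : ℝ) else 0 := by
    refine Finset.sum_le_sum fun v _ => ?_
    split_ifs
    · exact hx _
    · exact le_rfl
  rw [← Finset.sum_filter, Finset.sum_const, card_filter_mem_eq_ncard, nsmul_eq_mul] at hge
  rw [hsum', Finset.sum_const, nsmul_eq_mul, Finset.card_univ, ← Nat.card_eq_fintype_card] at hlt
  linarith

end IsGoodSet

/-! ### Approximation by cosets and normal subgroups -/

theorem isUnionOfCosets_of_mul_mem {G : Type*} [Group G] {H : Subgroup G} {S : Set G}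
    (h : ∀ g ∈ S, ∀ x ∈ H, g * x ∈ S) : IsUnionOfCosets H S := by
  refine ⟨S, Set.Subset.antisymm (fun g hg => ?_) (Set.iUnion₂_subset fun g hg => ?_)⟩
  · exact Set.mem_iUnion₂.2 ⟨g, hg, 1, H.one_mem, mul_one g⟩
  · rintro _ ⟨x, hx, rfl⟩
    exact h g hg x hx

/-- A stable set is, up to a small proportion of the group, right invariant under a subgroup of
polynomial index. -/
theorem IsKStable.exists_subgroup {G : Type*} [Group G] [Finite G] {k : ℕ} {A : Set G}
    (hA : IsKStable k A) {ε : ℝ} (hε : 0 < ε) (hε' : ε ≤ 1 / 2) :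
    ∃ (H : Subgroup G) (D : Set G),
      (H.index : ℝ) ≤ ε⁻¹ ^ (2 ^ HasBinaryTree.ladderHeight k * 3) ∧
      (∀ g ∈ D, ∀ x ∈ H, g * x ∈ D) ∧ ((A ∆ D).ncard : ℝ) < ε ^ 2 * Nat.card G := by
  have hN : (0 : ℝ) < Nat.card G := by exact_mod_cast Nat.card_pos
  obtain ⟨m, V, hm, hV, hgood⟩ := exists_isGoodSet A hε _ 0 Set.univ (by simp)
    hA.not_hasBinaryTree
  have hVpos : 0 < V.ncard := by
    have : (0 : ℝ) < V.ncard := lt_of_lt_of_le (by positivity) hV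
    exact_mod_cast this
  obtain ⟨x, hx⟩ := hgood.exists_smul_ncard_symmDiff_lt
  have hcard := (hgood.smul x).le_card_rightStabilizer (by positivity)
    (by rwa [Set.ncard_smul_set])
  rw [Set.ncard_smul_set] at hcard
  set D := goodDefinition A (ε ^ (m + 3)) (x • V) with hD
  refine ⟨rightStabilizer D, D, ?_, fun g hg y hy => (hy g).2 hg, hx.trans_le ?_⟩
  · have hpow : 0 < ε ^ m := pow_pos hε m
    have h₁ : ε ^ (m + 1) * Nat.card G ≤ Nat.card (rightStabilizer D) := by
      refine le_trans ?_ hcard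
      -- Goodness beats density by `ε ^ 3`, so the loss `2δ|G|` is negligible against `|V|`.
      have h₂ : ε ^ (m + 1) + 2 * ε ^ (m + 3) ≤ ε ^ m := by
        have h₃ : ε + 2 * ε ^ 3 ≤ 1 := by nlinarith [mul_pos hε hε]
        calc ε ^ (m + 1) + 2 * ε ^ (m + 3) = ε ^ m * (ε + 2 * ε ^ 3) := by ring
          _ ≤ ε ^ m * 1 := by gcongr
          _ = ε ^ m := mul_one _
      nlinarith
    have h₂ : (Nat.card (rightStabilizer D) : ℝ) * (rightStabilizer D).index = Nat.card G := by
      exact_mod_cast (rightStabilizer D).card_mul_index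
    have h₃ : ε ^ (m + 1) * (rightStabilizer D).index ≤ 1 := by
      have h₄ : ε ^ (m + 1) * Nat.card G * (rightStabilizer D).index ≤ Nat.card G := by
        rw [← h₂]
        rw [← h₂] at h₁
        gcongr
      have h₅ : Nat.card G * (ε ^ (m + 1) * (rightStabilizer D).index) ≤ Nat.card G * (1 : ℝ) := by
        linarith
      exact le_of_mul_le_mul_left h₅ hN
    calc ((rightStabilizer D).index : ℝ) ≤ ε⁻¹ ^ (m + 1) := by
          rw [inv_pow, ← one_div, le_div_iff₀ (by positivity), mul_comm]
          exact h₃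
      _ ≤ _ := pow_le_pow_right₀ ((one_le_inv₀ hε).2 (by linarith)) (by omega)
  · gcongr ?_ * _
    exact pow_le_pow_of_le_one hε.le (by linarith) (by omega)

/-- The core is the kernel of the action on the cosets of `H`. -/
theorem index_normalCore_le {G : Type*} [Group G] [Finite G] (H : Subgroup G) :
    H.normalCore.index ≤ 2 ^ H.index ^ 2 := by
  calc H.normalCore.index ≤ H.index.factorial := by
        rw [H.normalCore_eq_ker, Subgroup.index_ker, Subgroup.index, ← Nat.card_perm]
        exact Nat.card_le_card_of_injective _ Subtype.val_injective
    _ ≤ H.index ^ H.index := Nat.factorial_le_pow _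
    _ ≤ (2 ^ H.index) ^ H.index := Nat.pow_le_pow_left Nat.lt_two_pow_self.le _
    _ = 2 ^ H.index ^ 2 := by rw [← pow_mul, sq]

/-- If `A` is close to a union of cosets of `H`, then few cosets of `H` meet both `A` and its
complement substantially. -/
theorem exists_irregular_cosets {G : Type*} [Group G] [Finite G] {A D : Set G} {ε : ℝ}
    (hε : 0 < ε) (H : Subgroup G) (hD : ∀ g ∈ D, ∀ x ∈ H, g * x ∈ D)
    (hAD : ((A ∆ D).ncard : ℝ) < ε ^ 2 * Nat.card G) :
    ∃ Z : Set G, IsUnionOfCosets H Z ∧ (Z.ncard : ℝ) < ε * Nat.card G ∧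
      ∀ g : G, g ∉ Z →
        (((g • (H : Set G)) ∩ A).ncard : ℝ) < ε * Nat.card H ∨
        (((g • (H : Set G)) \ A).ncard : ℝ) < ε * Nat.card H := by
  classical
  have := Fintype.ofFinite G
  set Z : Set G := {g | ε * Nat.card H ≤ ((g • (H : Set G) ∩ A).ncard : ℝ) ∧
    ε * Nat.card H ≤ ((g • (H : Set G) \ A).ncard : ℝ)} with hZ
  refine ⟨Z, isUnionOfCosets_of_mul_mem fun g hg x hx => ?_, ?_, fun g hg => ?_⟩
  · have : (g * x) • (H : Set G) = g • (H : Set G) := by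
      rw [← smul_smul, smul_coe_set hx]
    simpa only [hZ, Set.mem_ofPred_eq, this] using hg
  · have hsum : (∑ g : G, ((g • (H : Set G) ∩ A ∆ D).ncard : ℝ)) =
        Nat.card H * (A ∆ D).ncard := by
      have := sum_ncard_smul_inter (H : Set G) (A ∆ D)
      exact_mod_cast this
    -- A coset lies inside `D` or misses it, so an irregular one has at least `ε|H|` points in `A ∆
    -- D`. This spends one of the two factors of `ε`.
    have hle : ∀ g : G, (if g ∈ Z then ε * Nat.card H else 0) ≤
        ((g • (H : Set G) ∩ A ∆ D).ncard : ℝ) := by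
      intro g
      split_ifs with hg
      · by_cases hgD : g ∈ D
        · refine hg.2.trans (Nat.cast_le.2 (Set.ncard_le_ncard ?_ (Set.toFinite _)))
          rintro _ ⟨⟨x, hx, rfl⟩, hA⟩
          exact ⟨⟨x, hx, rfl⟩, Or.inr ⟨hD g hgD x hx, hA⟩⟩
        · refine hg.1.trans (Nat.cast_le.2 (Set.ncard_le_ncard ?_ (Set.toFinite _)))
          rintro _ ⟨⟨x, hx, rfl⟩, hA⟩
          refine ⟨⟨x, hx, rfl⟩, Or.inl ⟨hA, fun h => hgD ?_⟩⟩
          simpa using hD _ h x⁻¹ (H.inv_mem hx)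
      · positivity
    have h₁ := Finset.sum_le_sum fun g (_ : g ∈ Finset.univ) => hle g
    rw [hsum, ← Finset.sum_filter, Finset.sum_const, card_filter_mem_eq_ncard, nsmul_eq_mul] at h₁
    have hH : (0 : ℝ) < Nat.card H := by exact_mod_cast Nat.card_pos
    have h₂ : (Nat.card H : ℝ) * (Z.ncard * ε) ≤ Nat.card H * (A ∆ D).ncard := by linarith
    have h₃ := (le_of_mul_le_mul_left h₂ hH).trans_lt hAD
    have h₄ : ε * Z.ncard < ε * (ε * Nat.card G) := by linarith
    exact lt_of_mul_lt_mul_left h₄ hε.le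
  · by_contra! h
    exact hg h

theorem trivial_regularity {G : Type*} [Group G] [Finite G] (A : Set G) {ε : ℝ}
    (hε : 1 / 2 < ε) :
    (∃ Z : Set G, IsUnionOfCosets (⊤ : Subgroup G) Z ∧ (Z.ncard : ℝ) < ε * Nat.card G ∧
      ∀ g : G, g ∉ Z →
        (((g • ((⊤ : Subgroup G) : Set G)) ∩ A).ncard : ℝ) < ε * Nat.card (⊤ : Subgroup G) ∨
        (((g • ((⊤ : Subgroup G) : Set G)) \ A).ncard : ℝ) < ε * Nat.card (⊤ : Subgroup G)) ∧
      ∃ D : Set G, IsUnionOfCosets (⊤ : Subgroup G) D ∧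
        ((A ∆ D).ncard : ℝ) < ε * Nat.card G := by
  have hN : (0 : ℝ) < Nat.card G := by exact_mod_cast Nat.card_pos
  have hsum : (A.ncard : ℝ) + Aᶜ.ncard = Nat.card G := by
    exact_mod_cast Set.ncard_add_ncard_compl A
  have hhalf : (A.ncard : ℝ) < ε * Nat.card G ∨ (Aᶜ.ncard : ℝ) < ε * Nat.card G := by
    by_contra! h
    nlinarith
  refine ⟨⟨∅, isUnionOfCosets_of_mul_mem (by simp), by simp; nlinarith, fun g _ => ?_⟩, ?_⟩
  · simpa [← Set.compl_eq_univ_sdiff] using hhalf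
  · rcases hhalf with h | h
    · exact ⟨∅, isUnionOfCosets_of_mul_mem (by simp), by simpa [← Set.bot_eq_empty] using h⟩
    · exact ⟨Set.univ, isUnionOfCosets_of_mul_mem (by simp), by
        simpa [← Set.top_eq_univ] using h⟩

theorem proposition4p2 (k : ℕ) :
    ∃ C : ℕ, ∀ (G : Type*) [Group G] [Finite G] (A : Set G), IsKStable k A →
      ∀ ε : ℝ, 0 < ε →
        ∃ H : Subgroup G, H.Normal ∧ (H.index : ℝ) ≤ (2 : ℝ) ^ ((ε⁻¹ ^ C : ℝ)) ∧
          (∃ Z : Set G, IsUnionOfCosets H Z ∧ (Z.ncard : ℝ) < ε * Nat.card G ∧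
            ∀ g : G, g ∉ Z →
              (((g • (H : Set G)) ∩ A).ncard : ℝ) < ε * Nat.card H ∨
              (((g • (H : Set G)) \ A).ncard : ℝ) < ε * Nat.card H) ∧
          (∃ D : Set G, IsUnionOfCosets H D ∧ ((A ∆ D).ncard : ℝ) < ε * Nat.card G) := by
  -- The last factor 2 absorbs the square in `index_normalCore_le`.
  refine ⟨2 ^ HasBinaryTree.ladderHeight k * 3 * 2, fun G _ _ A hA ε hε => ?_⟩
  -- For `ε > 1 / 2`, either `A` or its complement has fewer than `ε|G|` elements, so `⊤` works.
  rcases lt_or_ge (1 / 2) ε with hε' | hε'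
  · refine ⟨⊤, inferInstance, ?_, trivial_regularity A hε'⟩
    rw [Subgroup.index_top, Nat.cast_one]
    exact Real.one_le_rpow one_le_two (by positivity)
  obtain ⟨K, D, hK, hD, hAD⟩ := hA.exists_subgroup hε hε'
  have hD' : ∀ g ∈ D, ∀ x ∈ K.normalCore, g * x ∈ D := fun g hg x hx =>
    hD g hg x (K.normalCore_le hx)
  refine ⟨K.normalCore, inferInstance, ?_, exists_irregular_cosets hε _ hD' hAD,
    D, isUnionOfCosets_of_mul_mem hD', hAD.trans_le ?_⟩
  · calc (K.normalCore.index : ℝ) ≤ 2 ^ K.index ^ 2 := by exact_mod_cast index_normalCore_le K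
      _ = (2 : ℝ) ^ ((K.index : ℝ) ^ 2) := by
        rw [← Real.rpow_natCast]
        push_cast
        rfl
      _ ≤ _ := by
        refine Real.rpow_le_rpow_of_exponent_le one_le_two ?_
        rw [pow_mul]
        gcongr
  · gcongr
    nlinarith
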